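/- **Setting.** There are $n$ agents with type spaces $\Theta_i=[0,1]^m$, whose types are drawn independently, agent $i$'s from a distribution on $[0,1]^m$; $\mathcal D_{-i}$ denotes the (product) distribution of $\vec\theta_{-i}$, the types of all agents but $i$. Let $\mathcal M$ be a class of mechanisms, parametrized by a standard Borel space (for instance countable, or indexed by $\mathbb R^r$). For $M\in\mathcal M$ let $u_{i,M}(\theta_i,\hat\theta_i,\vec\theta_{-i})\in[-1,1]$ be agent $i$'s utility under $M$ when her true type is $\theta_i$, she reports $\hat\theta_i$, and the others truthfully report $\vec\theta_{-i}$; assume that it is jointly measurable in $(M,\theta_i,\hat\theta_i,\vec\theta_{-i})$. Let $\mathcal F_{i,\mathcal M}$ be the class of functions $\vec\theta_{-i}\mapsto u_{i,M}(\theta_i,\hat\theta_i,\vec\theta_{-i})$, $M\in\mathcal M$, $\theta_i,\hat\theta_i\in[0,1]^m$, and let $d_i$ be its pseudo-dimension (the largest size of a set of points $x$ for which there are thresholds $z_x\in\mathbb R$ such that each subset $T$ of the points has the form $T=\{x: f(x)\ge z_x\}$ for some $f\in\mathcal F_{i,\mathcal M}$). Let $N\ge1$ with $d_i\le N<\infty$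 for all $i$, and $\delta>0$. For each $i$ let $\mathcal S_{-i}=(\vec\theta_{-i}^{(1)},\dots,\vec\theta_{-i}^{(N)})\sim\mathcal D_{-i}^N$; the $\mathcal S_{-i}$ for different $i$ may depend on each other in any way. Put $$\epsilon_{i}(N,\delta)=4\sqrt{\frac{2d_i}{N}\ln\frac{eN}{d_i}}+4\sqrt{\frac1{2N}\ln\frac{2n}{\delta}}$$ (the first term is $0$ if $d_i=0$). "With probability $1-c$" means: outside an event of probability at most $c$. Functions $f_1,\dots,f_N:[0,1]^m\to\mathbb R$ are *piecewise $L$-Lipschitz and $(w,k)$-dispersed* if there are partitions $P_1,\dots,P_N$ of $[0,1]^m$ such that $f_j$ is $L$-Lipschitz for $\|\cdot\|_1$ on each part of $P_j$, and for every $p\in[0,1]^m$ the ball $\{q\in[0,1]^m:\|p-q\|_1\le w\}$ meets two or more parts of $P_j$ for at most $k$ indices $j$. A *$w$-grid* $\mathcal G_w$ is a finite subset of $[0,1]^m$ such that every point of $[0,1]^m$ is within $\ell_1$ distance $w$ of it (for example the uniform grid with edge-length $1/K$, if $m/(2K)\le w$). For $L_i\ge 0$ and $w_i,k_i\in\mathbb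 R$ ($i=1,\dots,n$) and $w_i$-grids $\mathcal G_{w_i}$, consider the conditions (D) for every $M\in\mathcal M$ and every agent $i$: for every $\theta_i\in[0,1]^m$ the functions $u_{i,M}(\theta_i,\cdot,\vec\theta_{-i}^{(j)})$, $j=1,\dots,N$, and for every $\hat\theta_i\in[0,1]^m$ the functions $u_{i,M}(\cdot,\hat\theta_i,\vec\theta_{-i}^{(j)})$, $j=1,\dots,N$, are piecewise $L_i$-Lipschitz and $(w_i,k_i)$-dispersed; (B) for every $M\in\mathcal M$, every agent $i$ and all $\theta_i,\hat\theta_i\in[0,1]^m$, $$\mathbb E_{\vec\theta_{-i}\sim\mathcal D_{-i}}\bigl[u_{i,M}(\theta_i,\hat\theta_i,\vec\theta_{-i})-u_{i,M}(\theta_i,\theta_i,\vec\theta_{-i})\bigr]\le\max_{p,\hat p\in\mathcal G_{w_i}}\frac1N\sum_{j=1}^N\bigl(u_{i,M}(p,\hat p,\vec\theta_{-i}^{(j)})-u_{i,M}(p,p,\vec\theta_{-i}^{(j)})\bigr)+4L_iw_i+\frac{8k_i}N+\epsilon_{i}(N,\delta).$$ **Theorem.** (1) For any fixed $L_i,w_i,k_i,\mathcal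 G_{w_i}$: if (D) holds with probability $1-\delta$ over the samples, then (B) holds with probability $1-2\delta$. (2) With probability $1-\delta$ over the samples, (B) holds for all $L_i,w_i,k_i,\mathcal G_{w_i}$ for which the drawn samples satisfy (D). -/

import Mathlib

open MeasureTheory ProbabilityTheory

namespace ApproxIC

/-- The type space `[0,1]^m`. -/
abbrev Cube (m : ℕ) : Type := Fin m → unitInterval

/-- The `ℓ₁` distance on `[0,1]^m`. -/
noncomputable def l1dist {m : ℕ} (x y : Cube m) : ℝ := ∑ l, |(x l : ℝ) - (y l : ℝ)|

/-- Type profiles `θ₋ᵢ` of all agents except agent `i`. -/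
abbrev Others (n m : ℕ) (i : Fin n) : Type := {j : Fin n // j ≠ i} → Cube m

/-- The full profile `(t, θ₋ᵢ)`. -/
def profile {n m : ℕ} (i : Fin n) (t : Cube m) (x : Others n m i) : Fin n → Cube m :=
  fun j => if h : j = i then t else x ⟨j, h⟩

/-- Given utilities `u M i θ θ'` (mechanism `M`, agent `i`, true profile `θ`, reported profile `θ'`),
the utility `u_{i,M}(t, r, θ₋ᵢ)` of agent `i` with true type `t` and reported type `r` when all the
other agents report truthfully. -/
def util {𝓜 : Type*} {n m : ℕ} (u : 𝓜 → Fin n → (Fin n → Cube m) → (Fin n → Cube m) → ℝ)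
    (i : Fin n) (M : 𝓜) (t r : Cube m) (x : Others n m i) : ℝ :=
  u M i (profile i t x) (profile i r x)

/-- The partition `P` (given by its equivalence relation) splits `A`:
`A` meets at least two parts of `P`. -/
def Splits {X : Type*} (P : Setoid X) (A : Set X) : Prop :=
  ∃ x ∈ A, ∃ y ∈ A, ¬ P x y

/-- `f` is `L`-Lipschitz with respect to the `ℓ₁` norm on each part of the partition `P`. -/
def LipschitzOnParts {m : ℕ} (L : ℝ) (P : Setoid (Cube m)) (f : Cube m → ℝ) : Prop :=
  ∀ x y, P x y → |f x - f y| ≤ L * l1dist x y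

/-- `f₁, …, f_N` are piecewise `L`-Lipschitz, with respect to partitions `P₁, …, P_N` such that every
`ℓ₁` ball of radius `w` is split by at most `k` of them, that is, they are piecewise `L`-Lipschitz
and `(w, k)`-dispersed. -/
def PiecewiseLipschitzDispersed {m N : ℕ} (L w k : ℝ) (f : Fin N → Cube m → ℝ) : Prop :=
  ∃ P : Fin N → Setoid (Cube m), (∀ j, LipschitzOnParts L (P j) (f j)) ∧
    ∀ p : Cube m, (({j | Splits (P j) {q | l1dist p q ≤ w}} : Set (Fin N)).ncard : ℝ) ≤ k

/-- The finite set `G` is a `w`-grid over `[0,1]^m`: each point of `[0,1]^m` is within `ℓ₁` distance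
`w` of a point of `G`. -/
def IsGrid {m : ℕ} (w : ℝ) (G : Finset (Cube m)) : Prop :=
  ∀ θ : Cube m, ∃ p ∈ G, l1dist θ p ≤ w

/-- The point with coordinates `a l / K`. -/
noncomputable def gridPoint {m : ℕ} (K : ℕ) (a : Fin m → Fin (K + 1)) : Cube m := fun l =>
  ⟨(a l : ℝ) / K, by positivity,
    div_le_one_of_le₀ (by exact_mod_cast Nat.lt_succ_iff.mp (a l).isLt) (by positivity)⟩

open Classical in
/-- The uniform grid with edge-length `1 / K` over `[0,1]^m`. -/
noncomputable def uniformGrid (m K : ℕ) : Finset (Cube m) := Finset.univ.image (gridPoint K)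

/-- A uniform grid is a `w`-grid as soon as its edge-length `1 / K` satisfies `m / (2 K) ≤ w`. -/
theorem isGrid_uniformGrid {m K : ℕ} (hK : 0 < K) {w : ℝ} (hw : m / (2 * K : ℝ) ≤ w) :
    IsGrid w (uniformGrid m K) := by
  classical
  intro θ
  have hK' : (0 : ℝ) < K := by exact_mod_cast hK
  have key : ∀ l, ∃ a : Fin (K + 1), |(θ l : ℝ) - (a : ℝ) / K| ≤ 1 / (2 * K : ℝ) := by
    intro l
    have h0 : (0 : ℝ) ≤ θ l := (θ l).2.1
    have h1 : (θ l : ℝ) ≤ 1 := (θ l).2.2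
    have hx : (0 : ℝ) ≤ θ l * K + 1 / 2 := by positivity
    have hfl := Nat.floor_le hx
    have hlt := Nat.lt_floor_add_one ((θ l : ℝ) * K + 1 / 2)
    have hle : ⌊(θ l : ℝ) * K + 1 / 2⌋₊ < K + 1 := by
      rw [Nat.floor_lt hx]
      push_cast
      nlinarith
    refine ⟨⟨_, hle⟩, ?_⟩
    have e : (θ l : ℝ) - (⌊(θ l : ℝ) * K + 1 / 2⌋₊ : ℝ) / K
        = (θ l * K - ⌊(θ l : ℝ) * K + 1 / 2⌋₊) / K := by field_simp
    have e' : 1 / (2 * K : ℝ) = (1 / 2) / K := by field_simp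
    simp only [e, e', abs_div, abs_of_pos hK']
    gcongr
    rw [abs_le]
    constructor <;> linarith
  choose a ha using key
  refine ⟨gridPoint K a, Finset.mem_image_of_mem _ (Finset.mem_univ _), le_trans ?_ hw⟩
  calc l1dist θ (gridPoint K a) ≤ ∑ _l : Fin m, 1 / (2 * K : ℝ) := Finset.sum_le_sum fun l _ => ha l
    _ = m / (2 * K : ℝ) := by simp [div_eq_mul_inv]

/-- The finite set `S` is shattered by the class `F` of real functions, with witness `z`. -/
def PseudoShatters {X : Type*} (F : Set (X → ℝ)) (S : Finset X) : Prop :=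
  ∃ z : X → ℝ, ∀ T ⊆ S, ∃ f ∈ F, ∀ x ∈ S, z x ≤ f x ↔ x ∈ T

/-- The pseudo-dimension: the largest size of a shattered set (`⊤` if there is no largest). -/
noncomputable def pdim {X : Type*} (F : Set (X → ℝ)) : ℕ∞ :=
  ⨆ (S : Finset X) (_ : PseudoShatters F S), (S.card : ℕ∞)

/-- The class of the functions `θ₋ᵢ ↦ u_{i,M}(t, r, θ₋ᵢ)`, over all mechanisms `M` and all types
`t, r` of agent `i`. -/
def utilClass {𝓜 : Type*} {n m : ℕ} (u : 𝓜 → Fin n → (Fin n → Cube m) → (Fin n → Cube m) → ℝ)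
    (i : Fin n) : Set (Others n m i → ℝ) :=
  {f | ∃ (M : 𝓜) (t r : Cube m), f = util u i M t r}

/-- The distribution of `θ₋ᵢ` when agent `j`'s type has law `ν j`, independently over `j`. -/
noncomputable def othersLaw {n m : ℕ} (ν : Fin n → Measure (Cube m)) (i : Fin n) :
    Measure (Others n m i) :=
  Measure.pi fun j : {j : Fin n // j ≠ i} => ν j

/-- The expected gain of agent `i` with true type `t` from reporting `r`. -/
noncomputable def expGain {𝓜 : Type*} {n m : ℕ}
    (u : 𝓜 → Fin n → (Fin n → Cube m) → (Fin n → Cube m) → ℝ)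
    (ν : Fin n → Measure (Cube m)) (i : Fin n) (M : 𝓜) (t r : Cube m) : ℝ :=
  ∫ x, (util u i M t r x - util u i M t t x) ∂(othersLaw ν i)

/-- The average gain over the sample `s` of agent `i` with true type `t` from reporting `r`. -/
noncomputable def empGain {𝓜 : Type*} {n m N : ℕ}
    (u : 𝓜 → Fin n → (Fin n → Cube m) → (Fin n → Cube m) → ℝ)
    (i : Fin n) (s : Fin N → Others n m i) (M : 𝓜) (t r : Cube m) : ℝ :=
  (1 / (N : ℝ)) * ∑ j, (util u i M t r (s j) - util u i M t t (s j))

/-- On the samples `s`, for every mechanism and every agent `i`, the sample utilities, both as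
functions of the reported type and as functions of the true type, are piecewise `L i`-Lipschitz and
`(w i, k i)`-dispersed. -/
def DispersionHolds {𝓜 : Type*} {n m N : ℕ}
    (u : 𝓜 → Fin n → (Fin n → Cube m) → (Fin n → Cube m) → ℝ)
    (L w k : Fin n → ℝ) (s : ∀ i : Fin n, Fin N → Others n m i) : Prop :=
  ∀ (M : 𝓜) (i : Fin n),
    (∀ t : Cube m,
      PiecewiseLipschitzDispersed (L i) (w i) (k i) fun j r => util u i M t r (s i j)) ∧
    (∀ r : Cube m,
      PiecewiseLipschitzDispersed (L i) (w i) (k i) fun j t => util u i M t r (s i j))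

/-- The estimation error for `n` agents, `N` samples and pseudo-dimension `d`. -/
noncomputable def estError (n N : ℕ) (δ : ℝ) (d : ℕ) : ℝ :=
  4 * √(2 * d / N * Real.log (Real.exp 1 * N / d)) + 4 * √(1 / (2 * N) * Real.log (2 * n / δ))

/-- On the samples `s`, for every mechanism and every agent, the true incentive compatibility gap is
at most the maximum empirical gain over the grid, plus the error terms. -/
def GapBound {𝓜 : Type*} {n m N : ℕ}
    (u : 𝓜 → Fin n → (Fin n → Cube m) → (Fin n → Cube m) → ℝ)
    (ν : Fin n → Measure (Cube m)) (δ : ℝ) (d : Fin n → ℕ)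
    (L w k : Fin n → ℝ) (G : Fin n → Finset (Cube m))
    (s : ∀ i : Fin n, Fin N → Others n m i) : Prop :=
  ∀ (M : 𝓜) (i : Fin n) (t r : Cube m),
    expGain u ν i M t r ≤
      (⨆ p : G i × G i, empGain u i (s i) M p.1 p.2)
        + 4 * L i * w i + 8 * k i / N + estError n N δ (d i)

end ApproxIC

open ApproxIC

/-! The proof has a probabilistic half and a deterministic half, which meet at the empirical gain of
an arbitrary pair of types.

Probabilistic half: outside an event of probability `δ / (2 * n)`, every expected gain of agent `i`
is at most its empirical gain plus `estError` (`measure_exists_expGain_gt_le`). The largest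
deviation changes by at most `4 / N` when one sample point changes, so McDiarmid's inequality
concentrates it around its mean. Symmetrization with a ghost sample bounds this mean by random-sign
sums. A gain is a difference of two functions of `utilClass` and there are two samples, hence four
sums. Each is controlled by the pseudo-dimension: a function with values in `[-1,1]` is an average
of signs of its superlevel sets, the traces of these sets on the sample are few by Sauer–Shelah, and
Massart's lemma bounds sign sums over few sets.

Deterministic half: on any sample satisfying dispersion, moving both types to the grid changes the
empirical gain by at most `4 * L * w + 8 * k / N` (`empGain_le_of_dispersionHolds`). The exceptional
event of the first half involves neither `L`, `w`, `k` nor the grid, so the bound is uniform in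
them. The version with fixed parameters follows by a union bound.

Suprema over uncountably many mechanisms and types need not be Borel. They are measurable for the
completed measure, because projections of Borel sets are analytic. -/

/-! ### Universal measurability of analytic sets and of suprema over a standard Borel parameter. -/

section UniversalMeasurability

open Set Filter Topology

/-- An analytic set is approximated in measure from inside by compact sets. -/
theorem analyticSet_exists_isCompact_le_measure {Y : Type*} [TopologicalSpace Y]
    [TopologicalSpace.MetrizableSpace Y] [MeasurableSpace Y] [BorelSpace Y] (μ : Measure Y)
    [IsFiniteMeasure μ] {A : Set Y} (hA : AnalyticSet A) {c : ENNReal} (hc : c < μ A) :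
    ∃ K ⊆ A, IsCompact K ∧ c ≤ μ K := by
  let := TopologicalSpace.metrizableSpaceMetric Y
  rw [AnalyticSet] at hA
  rcases hA with rfl | ⟨φ, hφ, rfl⟩
  · simp at hc
  -- One coordinate of Baire space at a time is bounded, keeping the outer measure of the image
  -- above `c`; the bounds `b` together define a compact box.
  have step : ∀ (k : ℕ) (S : {S : Set (ℕ → ℕ) // c < μ (φ '' S)}),
      ∃ m : ℕ, c < μ (φ '' (S.1 ∩ {x | x k ≤ m})) := by
    intro k S
    have hmono : Monotone fun m : ℕ => φ '' (S.1 ∩ {x | x k ≤ m}) := fun a b hab =>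
      image_mono (inter_subset_inter_right _ fun x (hx : x k ≤ a) => hx.trans hab)
    have hU : φ '' S.1 = ⋃ m : ℕ, φ '' (S.1 ∩ {x | x k ≤ m}) := by
      rw [← image_iUnion, ← inter_iUnion]
      congr 1
      refine (inter_eq_left.2 fun x _ => mem_iUnion.2 ⟨x k, le_refl (x k)⟩).symm
    have := S.2
    rw [hU, hmono.measure_iUnion] at this
    exact lt_iSup_iff.1 this
  choose g hg using step
  let seq : ℕ → {S : Set (ℕ → ℕ) // c < μ (φ '' S)} := fun k =>
    Nat.rec ⟨univ, by rwa [image_univ]⟩ (fun k S => ⟨S.1 ∩ {x | x k ≤ g k S}, hg k S⟩) k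
  let b : ℕ → ℕ := fun k => g k (seq k)
  have hseq : ∀ k, (seq (k + 1)).1 = (seq k).1 ∩ {x | x k ≤ b k} := fun k => rfl
  have hanti : Antitone fun k => (seq k).1 :=
    antitone_nat_of_succ_le fun k => by rw [hseq]; exact inter_subset_left
  have hle : ∀ k, ∀ x ∈ (seq k).1, ∀ i < k, x i ≤ b i := by
    intro k x hx i hi
    have : x ∈ (seq (i + 1)).1 := hanti hi hx
    rw [hseq] at this
    exact this.2
  have hK : IsCompact (Set.pi univ fun i => Iic (b i)) :=
    isCompact_univ_pi fun i => (finite_Iic (b i)).isCompact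
  refine ⟨φ '' Set.pi univ fun i => Iic (b i), image_subset_range _ _, hK.image hφ, ?_⟩
  -- The images of the sets `seq k` need not be measurable, so continuity from above is applied to
  -- their closures. This inclusion shows that nothing outside the image of the box is gained in the
  -- limit.
  have hsub : (⋂ k, closure (φ '' (seq k).1)) ⊆ φ '' Set.pi univ fun i => Iic (b i) := by
    intro y hy
    have hx : ∀ k : ℕ, ∃ x ∈ (seq k).1, dist y (φ x) < 1 / ((k : ℝ) + 1) := by
      intro k
      obtain ⟨_, ⟨x, hx, rfl⟩, h⟩ :=
        Metric.mem_closure_iff.1 (mem_iInter.1 hy k) (1 / ((k : ℝ) + 1)) (by positivity)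
      exact ⟨x, hx, h⟩
    choose x hx hd using hx
    -- The points `x k` obey only the first `k` bounds. Truncation puts them into the box, and each
    -- fixed coordinate is eventually unaffected by it.
    obtain ⟨z, hz, ψ, hψ, hlim⟩ := hK.tendsto_subseq (x := fun k i => min (x k i) (b i))
      fun k i _ => mem_Iic.2 (min_le_right _ _)
    have hlim' : Tendsto (fun k => x (ψ k)) atTop (𝓝 z) := by
      rw [tendsto_pi_nhds] at hlim ⊢
      intro i
      refine (hlim i).congr' ?_
      filter_upwards [eventually_gt_atTop i] with k hk
      exact min_eq_left (hle _ _ (hx _) i (hk.trans_le hψ.le_apply))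
    refine ⟨z, hz, tendsto_nhds_unique ((hφ.tendsto z).comp hlim') ?_⟩
    rw [tendsto_iff_dist_tendsto_zero]
    refine squeeze_zero (fun _ => dist_nonneg) (fun k => ?_)
      (tendsto_one_div_add_atTop_nhds_zero_nat.comp hψ.tendsto_atTop)
    rw [dist_comm]
    exact (hd (ψ k)).le
  refine le_trans ?_ (measure_mono hsub)
  refine ge_of_tendsto' (tendsto_measure_iInter_atTop
    (fun k => isClosed_closure.measurableSet.nullMeasurableSet)
    (fun i j hij => closure_mono (image_mono (hanti hij))) ⟨0, measure_ne_top _ _⟩) fun k => ?_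
  exact (seq k).2.le.trans (measure_mono subset_closure)

/-- Analytic sets are universally measurable. -/
theorem analyticSet_nullMeasurableSet {Y : Type*} [TopologicalSpace Y]
    [TopologicalSpace.MetrizableSpace Y] [MeasurableSpace Y] [BorelSpace Y] (μ : Measure Y)
    [IsFiniteMeasure μ] {A : Set Y} (hA : AnalyticSet A) : NullMeasurableSet A μ := by
  rcases eq_or_ne (μ A) 0 with h0 | h0
  · exact NullMeasurableSet.of_null h0
  obtain ⟨c, -, hc, hlim⟩ := exists_seq_strictMono_tendsto' (pos_iff_ne_zero.2 h0)
  choose K hKA hK hcK using fun k => analyticSet_exists_isCompact_le_measure μ hA (hc k).2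
  have hm : MeasurableSet (⋃ k, K k) := MeasurableSet.iUnion fun k => (hK k).measurableSet
  refine hm.nullMeasurableSet.congr
    (ae_eq_of_subset_of_measure_ge (iUnion_subset hKA) ?_ hm.nullMeasurableSet (measure_ne_top _ _))
  exact le_of_tendsto' hlim fun k => (hcK k).trans (measure_mono (subset_iUnion K k))

/-- The projection of a measurable set is universally measurable. -/
theorem nullMeasurableSet_setOf_exists {Θ Y : Type*} [MeasurableSpace Θ] [StandardBorelSpace Θ]
    [MeasurableSpace Y] [StandardBorelSpace Y] (μ : Measure Y) [IsFiniteMeasure μ]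
    {B : Set (Θ × Y)} (hB : MeasurableSet B) : NullMeasurableSet {y | ∃ θ, (θ, y) ∈ B} μ := by
  let := upgradeStandardBorel Y
  have h : {y | ∃ θ, (θ, y) ∈ B} = Prod.snd '' B := by
    ext y
    simp
  rw [h]
  exact analyticSet_nullMeasurableSet μ (hB.analyticSet_image measurable_snd)

/-- A supremum of jointly measurable functions over a standard Borel parameter space is
universally measurable. -/
theorem aemeasurable_iSup_param {Θ Y : Type*} [MeasurableSpace Θ] [StandardBorelSpace Θ] [Nonempty Θ]
    [MeasurableSpace Y] [StandardBorelSpace Y] (μ : Measure Y) [IsFiniteMeasure μ]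
    {φ : Θ → Y → ℝ} (hφ : Measurable (Function.uncurry φ)) (hb : ∀ y, BddAbove (range fun θ => φ θ y)) :
    AEMeasurable (fun y => ⨆ θ, φ θ y) μ := by
  have : NullMeasurable (fun y => ⨆ θ, φ θ y) μ := by
    refine measurable_of_Ioi (δ := NullMeasurableSpace Y μ) fun a => ?_
    -- A supremum exceeds `a` exactly when some member does, so this set is the projection of a
    -- measurable set.
    have h : (fun y => ⨆ θ, φ θ y) ⁻¹' Ioi a = {y | ∃ θ, (θ, y) ∈ Function.uncurry φ ⁻¹' Ioi a} := by
      ext y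
      exact lt_ciSup_iff (hb y)
    exact h ▸ nullMeasurableSet_setOf_exists μ (hφ measurableSet_Ioi)
  exact (aestronglyMeasurable_iff_nullMeasurable_separable.2
    ⟨this, univ, TopologicalSpace.IsSeparable.of_separableSpace _, by simp⟩).aemeasurable

end UniversalMeasurability

/-! ### McDiarmid's inequality, by induction on the number of coordinates. -/

section BoundedDifferences

/-- **McDiarmid's inequality**, as a bound on the moment generating function. -/
theorem hasSubgaussianMGF_of_boundedDifferences {X : Type*} [MeasurableSpace X] (μ : Measure X)
    [IsProbabilityMeasure μ] {c : NNReal} {C : ℝ} :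
    ∀ {N : ℕ} {F : (Fin N → X) → ℝ} (_ : AEMeasurable F (Measure.pi fun _ => μ))
      (_ : ∀ s, |F s| ≤ C) (_ : ∀ s j x, |F s - F (Function.update s j x)| ≤ c),
      HasSubgaussianMGF (fun s => F s - ∫ s', F s' ∂Measure.pi fun _ : Fin N => μ)
        (N * (c / 2) ^ 2) (Measure.pi fun _ : Fin N => μ)
  | 0, F, _, _, _ => by
    have h : (fun s => F s - ∫ s', F s' ∂Measure.pi fun _ : Fin 0 => μ) = fun _ => 0 := by
      funext s
      have : F = fun _ => F s := funext fun s' => congrArg F (Subsingleton.elim _ _)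
      rw [sub_eq_zero]
      conv_rhs => rw [this]
      simp
    rw [h]
    simp
  | N + 1, F, hm, hC, hF => by
    set ρ : Measure (Fin N → X) := Measure.pi fun _ : Fin N => μ
    set κ : Measure (Fin (N + 1) → X) := Measure.pi fun _ : Fin (N + 1) => μ
    have hmp : MeasurePreserving (MeasurableEquiv.piFinSuccAbove (fun _ => X) 0).symm (μ.prod ρ) κ :=
      (measurePreserving_piFinSuccAbove (fun _ : Fin (N + 1) => μ) 0).symm _
    set H : X × (Fin N → X) → ℝ := fun p => F (Fin.cons p.1 p.2)
    have hH : H = F ∘ (MeasurableEquiv.piFinSuccAbove (fun _ => X) 0).symm := by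
      funext p
      simp only [H, Function.comp]
      congr 1
      exact (Fin.insertNth_zero (α := fun _ => X) p.1 p.2).symm
    have hHm : AEStronglyMeasurable H (μ.prod ρ) := by
      rw [hH]
      exact (hm.comp_quasiMeasurePreserving hmp.quasiMeasurePreserving).aestronglyMeasurable
    have hHC : ∀ p, |H p| ≤ C := fun p => hC _
    have hHint : Integrable H (μ.prod ρ) :=
      Integrable.of_bound hHm C (Filter.Eventually.of_forall hHC)
    -- `G` is the conditional mean given the first coordinate. It ranges over an interval of length
    -- `c`, so Hoeffding's lemma applies to it; the fluctuation of `F` around `G` is handled by the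
    -- induction hypothesis, and the two exponents add up.
    set G : X → ℝ := fun x => ∫ y, H (x, y) ∂ρ
    have hGm : AEStronglyMeasurable G μ := hHm.integral_prod_right'
    have hGood : ∀ᵐ x ∂μ, AEStronglyMeasurable (fun y => H (x, y)) ρ := hHm.prodMk_left
    have hint : ∫ s', F s' ∂κ = ∫ x, G x ∂μ := by
      rw [← hmp.integral_comp', ← integral_prod H hHint, hH]
      rfl
    have hGC : ∀ x, |G x| ≤ C := fun x => by
      have := norm_integral_le_of_norm_le_const (μ := ρ) (f := fun y => H (x, y))
        (Filter.Eventually.of_forall fun y => hHC (x, y))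
      simpa using this
    have hG : ∃ a : ℝ, ∀ᵐ x ∂μ, G x ∈ Set.Icc a (a + c) := by
      -- Since `F` is only a.e. measurable, a null set of sections may fail to be measurable, and
      -- there the integral has the default value `0`. The interval is therefore anchored at the
      -- infimum over the good sections only.
      let T : Set X := {x | AEStronglyMeasurable (fun y => H (x, y)) ρ}
      have hbdd : BddBelow (G '' T) := ⟨-C, by rintro _ ⟨x, -, rfl⟩; exact (abs_le.1 (hGC x)).1⟩
      have hT : T.Nonempty := hGood.exists
      refine ⟨sInf (G '' T), hGood.mono fun x hx => ⟨csInf_le hbdd ⟨x, hx, rfl⟩, ?_⟩⟩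
      rw [← sub_le_iff_le_add]
      refine le_csInf (hT.image G) ?_
      rintro _ ⟨x', hx', rfl⟩
      rw [sub_le_iff_le_add', ← sub_le_iff_le_add]
      have hi : ∀ z ∈ T, Integrable (fun y => H (z, y)) ρ := fun z hz =>
        Integrable.of_bound hz C (Filter.Eventually.of_forall fun y => hHC (z, y))
      rw [← integral_sub (hi x hx) (hi x' hx')]
      have := integral_mono (μ := ρ) ((hi x hx).sub (hi x' hx')) (integrable_const (c : ℝ))
        fun y => (le_abs_self _).trans (by
          have := hF (Fin.cons x y) 0 x'
          rwa [Fin.update_cons_zero] at this)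
      simpa using this
    obtain ⟨a, ha⟩ := hG
    have hhoeff := hasSubgaussianMGF_of_mem_Icc hGm.aemeasurable ha
    have hinner : ∀ᵐ x ∂μ, HasSubgaussianMGF (fun y => H (x, y) - G x) (N * (c / 2) ^ 2) ρ := by
      filter_upwards [hGood] with x hx
      refine hasSubgaussianMGF_of_boundedDifferences μ hx.aemeasurable (fun y => hHC (x, y))
        fun y j z => ?_
      have := hF (Fin.cons x y) j.succ z
      rwa [← Fin.cons_update] at this
    have hexp : ∀ t : ℝ, Integrable (fun s => Real.exp (t * (F s - ∫ s', F s' ∂κ))) κ := fun t =>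
      integrable_exp_mul_of_mem_Icc (a := -C - ∫ s', F s' ∂κ) (b := C - ∫ s', F s' ∂κ)
        (hm.sub_const _) (Filter.Eventually.of_forall fun s => by
          have := abs_le.1 (hC s)
          constructor <;> linarith)
    refine ⟨hexp, fun t => ?_⟩
    have hcomp : Integrable (fun p => Real.exp (t * (H p - ∫ x, G x ∂μ))) (μ.prod ρ) := by
      have := (hmp.integrable_comp_emb (MeasurableEquiv.measurableEmbedding _)).2 (hexp t)
      rw [hH, ← hint]
      exact this
    calc mgf (fun s => F s - ∫ s', F s' ∂κ) κ t
        = ∫ p, Real.exp (t * (H p - ∫ x, G x ∂μ)) ∂μ.prod ρ := by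
          rw [mgf, ← hmp.integral_comp', hint, hH]
          rfl
      _ = ∫ x, ∫ y, Real.exp (t * (H (x, y) - ∫ x, G x ∂μ)) ∂ρ ∂μ := integral_prod _ hcomp
      _ ≤ ∫ x, Real.exp (t * (G x - ∫ x, G x ∂μ)) * Real.exp ((N * (c / 2) ^ 2 : NNReal) * t ^ 2 / 2) ∂μ := by
          refine integral_mono_ae hcomp.integral_prod_left
            ((hhoeff.integrable_exp_mul t).mul_const _) ?_
          filter_upwards [hinner] with x hx
          have : ∀ y, Real.exp (t * (H (x, y) - ∫ x, G x ∂μ))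
              = Real.exp (t * (G x - ∫ x, G x ∂μ)) * Real.exp (t * (H (x, y) - G x)) := fun y => by
            rw [← Real.exp_add]
            ring_nf
          simp only [this]
          rw [integral_const_mul]
          exact mul_le_mul_of_nonneg_left (hx.mgf_le t) (Real.exp_pos _).le
      _ ≤ Real.exp (((‖a + c - a‖₊ / 2) ^ 2 : NNReal) * t ^ 2 / 2)
            * Real.exp ((N * (c / 2) ^ 2 : NNReal) * t ^ 2 / 2) := by
          rw [integral_mul_const]
          exact mul_le_mul_of_nonneg_right (hhoeff.mgf_le t) (Real.exp_pos _).le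
      _ = Real.exp (((N + 1 : ℕ) * (c / 2) ^ 2 : NNReal) * t ^ 2 / 2) := by
          rw [← Real.exp_add]
          have : ‖a + c - a‖₊ = c := by
            rw [add_sub_cancel_left]
            simp
          rw [this]
          push_cast
          ring_nf

end BoundedDifferences

/-! ### Rademacher sums bounded by the pseudo-dimension. -/

section RademacherComplexity

open Finset

/-- The sign `±1` given by a Boolean. -/
def boolSign (b : Bool) : ℝ := if b then 1 else -1

/-- Independence of the signs factors the sum into hyperbolic cosines, each at most `exp (t ^ 2 /
2)` because `w j = ±1`. -/
theorem sum_exp_signs_le {N : ℕ} (t : ℝ) (w : Fin N → ℝ) (hw : ∀ j, w j ^ 2 = 1) :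
    ∑ σ : Fin N → Bool, Real.exp (t * ∑ j, boolSign (σ j) * w j)
      ≤ 2 ^ N * Real.exp (N * t ^ 2 / 2) := by
  have h : ∀ σ : Fin N → Bool, Real.exp (t * ∑ j, boolSign (σ j) * w j)
      = ∏ j, Real.exp (t * (boolSign (σ j) * w j)) := fun σ => by
    rw [mul_sum, Real.exp_sum]
  simp only [h]
  rw [← Fintype.piFinset_univ,
    ← Finset.prod_univ_sum (fun _ => univ) fun j b => Real.exp (t * (boolSign b * w j))]
  calc ∏ j, ∑ b, Real.exp (t * (boolSign b * w j)) ≤ ∏ _j : Fin N, 2 * Real.exp (t ^ 2 / 2) := by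
        refine prod_le_prod (fun j _ => sum_nonneg fun b _ => (Real.exp_pos _).le) fun j _ => ?_
        have := Real.cosh_le_exp_half_sq (t * w j)
        rw [mul_pow, hw, mul_one, Real.cosh_eq] at this
        simp only [Fintype.sum_bool, boolSign]
        simp only [if_true, Bool.false_eq_true, if_false, one_mul, neg_mul, mul_neg]
        linarith
    _ = 2 ^ N * Real.exp (N * t ^ 2 / 2) := by
        rw [prod_const, card_univ, Fintype.card_fin, mul_pow, ← Real.exp_nat_mul]
        ring_nf

/-- **Massart's lemma**: selecting, for each choice of signs, a set from a family `A`. -/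
theorem sum_signs_le_of_log_card_le {N : ℕ} (hN : 0 < N) (A : Finset (Finset (Fin N)))
    {ℓ : ℝ} (hA : Real.log (#A) ≤ ℓ) (a : (Fin N → Bool) → Finset (Fin N)) (ha : ∀ σ, a σ ∈ A) :
    ∑ σ : Fin N → Bool, ∑ j, boolSign (σ j) * (if j ∈ a σ then 1 else -1)
      ≤ 2 ^ N * √(2 * N * ℓ) := by
  set W : Finset (Fin N) → Fin N → ℝ := fun T j => if j ∈ T then 1 else -1
  have hW : ∀ T j, W T j ^ 2 = 1 := fun T j => by
    simp only [W]
    split_ifs <;> norm_num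
  set S := ∑ σ : Fin N → Bool, ∑ j, boolSign (σ j) * W (a σ) j
  set m := S / 2 ^ N
  have h2 : (0 : ℝ) < 2 ^ N := by positivity
  have hN' : (0 : ℝ) < N := by exact_mod_cast hN
  have hApos : (0 : ℝ) < #A := by exact_mod_cast card_pos.2 ⟨_, ha fun _ => true⟩
  -- Jensen's inequality for `exp`, after which the selected set is replaced by the sum over all of
  -- `A`; this costs the factor `#A`.
  have key : ∀ t : ℝ, t * m ≤ ℓ + N * t ^ 2 / 2 := by
    intro t
    have hJ := convexOn_exp.map_sum_le (t := (univ : Finset (Fin N → Bool)))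
      (w := fun _ => (1 : ℝ) / 2 ^ N) (p := fun σ => t * ∑ j, boolSign (σ j) * W (a σ) j)
      (fun _ _ => by positivity) (by simp) (fun _ _ => Set.mem_univ _)
    simp only [smul_eq_mul, ← mul_sum] at hJ
    have e : 1 / 2 ^ N * (t * S) = t * m := by
      simp only [m]
      ring
    change Real.exp (1 / 2 ^ N * (t * S)) ≤ _ at hJ
    rw [e] at hJ
    have hbound : ∑ σ : Fin N → Bool, Real.exp (t * ∑ j, boolSign (σ j) * W (a σ) j)
        ≤ #A * (2 ^ N * Real.exp (N * t ^ 2 / 2)) := by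
      calc _ ≤ ∑ σ : Fin N → Bool, ∑ T ∈ A, Real.exp (t * ∑ j, boolSign (σ j) * W T j) :=
            sum_le_sum fun σ _ => single_le_sum
              (f := fun T => Real.exp (t * ∑ j, boolSign (σ j) * W T j))
              (fun T _ => (Real.exp_pos _).le) (ha σ)
        _ = ∑ T ∈ A, ∑ σ : Fin N → Bool, Real.exp (t * ∑ j, boolSign (σ j) * W T j) := sum_comm
        _ ≤ ∑ _T ∈ A, 2 ^ N * Real.exp (N * t ^ 2 / 2) :=
            sum_le_sum fun T _ => sum_exp_signs_le t (W T) (hW T)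
        _ = _ := by rw [sum_const, nsmul_eq_mul]
    have : Real.exp (t * m) ≤ #A * Real.exp (N * t ^ 2 / 2) := by
      refine hJ.trans ?_
      rw [one_div, inv_mul_le_iff₀ h2]
      linarith
    have := Real.log_le_log (Real.exp_pos _) this
    rw [Real.log_exp, Real.log_mul hApos.ne' (Real.exp_pos _).ne', Real.log_exp] at this
    linarith
  have hm : m ≤ √(2 * N * ℓ) := by
    refine Real.le_sqrt_of_sq_le ?_
    -- The choice `t = m / N` maximizes `t * m - N * t ^ 2 / 2`.
    have := key (m / N)
    have e : m / N * m = m ^ 2 / N := by ring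
    have e' : N * (m / N) ^ 2 / 2 = m ^ 2 / N / 2 := by field_simp
    rw [e, e'] at this
    have h3 : m ^ 2 / N ≤ 2 * ℓ := by linarith
    rw [div_le_iff₀ hN'] at h3
    linarith
  have : S = 2 ^ N * m := by
    simp only [m]
    field_simp
  rw [this]
  gcongr

/-- Weighting by `(d / N) ^ d ≤ (d / N) ^ k` for `k ≤ d` and completing to the full binomial sum
gives `(1 + d / N) ^ N ≤ exp d`. For `d = 0` both sides vanish. -/
theorem log_sum_choose_le {N d : ℕ} (hdN : d ≤ N) :
    Real.log ((∑ k ∈ Iic d, N.choose k : ℕ) : ℝ) ≤ d * Real.log (Real.exp 1 * N / d) := by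
  rcases Nat.eq_zero_or_pos d with rfl | hd
  · have : Iic 0 = ({0} : Finset ℕ) := rfl
    simp [this]
  have hd' : (0 : ℝ) < d := by exact_mod_cast hd
  have hN' : (0 : ℝ) < N := by exact_mod_cast hd.trans_le hdN
  have hx0 : (0 : ℝ) < d / N := by positivity
  have hx1 : (d / N : ℝ) ≤ 1 := div_le_one_of_le₀ (by exact_mod_cast hdN) hN'.le
  have h1 : (d / N : ℝ) ^ d * ((∑ k ∈ Iic d, N.choose k : ℕ) : ℝ) ≤ Real.exp d := by
    calc (d / N : ℝ) ^ d * ((∑ k ∈ Iic d, N.choose k : ℕ) : ℝ)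
        = ∑ k ∈ Iic d, (d / N : ℝ) ^ d * N.choose k := by push_cast; rw [mul_sum]
      _ ≤ ∑ k ∈ Iic d, (d / N : ℝ) ^ k * N.choose k := sum_le_sum fun k hk =>
          mul_le_mul_of_nonneg_right (pow_le_pow_of_le_one hx0.le hx1 (mem_Iic.1 hk)) (by positivity)
      _ ≤ ∑ k ∈ range (N + 1), (d / N : ℝ) ^ k * N.choose k :=
          sum_le_sum_of_subset_of_nonneg
            (fun k hk => mem_range.2 (Nat.lt_succ_of_le ((mem_Iic.1 hk).trans hdN)))
            fun _ _ _ => by positivity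
      _ = (d / N + 1 : ℝ) ^ N := by simp [add_pow]
      _ ≤ Real.exp (d / N) ^ N := by gcongr; exact Real.add_one_le_exp _
      _ = Real.exp d := by rw [← Real.exp_nat_mul]; congr 1; field_simp
  have hpos : (0 : ℝ) < ((∑ k ∈ Iic d, N.choose k : ℕ) : ℝ) := by
    exact_mod_cast sum_pos' (fun _ _ => Nat.zero_le _) ⟨0, by simp, by simp⟩
  have h2 := Real.log_le_log (by positivity) h1
  rw [Real.log_mul (by positivity) hpos.ne', Real.log_pow, Real.log_exp,
    Real.log_div hd'.ne' hN'.ne'] at h2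
  rw [Real.log_div (by positivity) hd'.ne', Real.log_mul (Real.exp_pos _).ne' hN'.ne', Real.log_exp]
  linarith

open Classical in
/-- The traces on the points `x` of the superlevel sets, at height `z`, of the functions in `F`. -/
noncomputable def superlevelTraces {X : Type*} {N : ℕ} (F : Set (X → ℝ)) (x : Fin N → X) (z : ℝ) :
    Finset (Finset (Fin N)) :=
  univ.filter fun T => ∃ f ∈ F, ∀ j, j ∈ T ↔ z ≤ f (x j)

theorem mem_superlevelTraces {X : Type*} {N : ℕ} {F : Set (X → ℝ)} {x : Fin N → X} {z : ℝ}
    {T : Finset (Fin N)} : T ∈ superlevelTraces F x z ↔ ∃ f ∈ F, ∀ j, j ∈ T ↔ z ≤ f (x j) := by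
  classical
  simp [superlevelTraces]

/-- The constant threshold `z` witnesses pseudo-shattering of the image of `J`. No two indices of
`J` can carry the same point, since every trace contains both or neither. -/
theorem card_le_pdim_of_shatters_superlevelTraces {X : Type*} {N : ℕ} {F : Set (X → ℝ)}
    {x : Fin N → X} {z : ℝ} {J : Finset (Fin N)} (hJ : (superlevelTraces F x z).Shatters J) :
    (#J : ℕ∞) ≤ pdim F := by
  classical
  have hinj : Set.InjOn x J := by
    intro i hi j hj hij
    by_contra hne
    obtain ⟨u, hu, huj⟩ := hJ (singleton_subset_iff.2 hi)
    obtain ⟨f, -, hfu⟩ := mem_superlevelTraces.1 hu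
    have hiu : i ∈ u := (mem_inter.1 (huj ▸ mem_singleton_self i)).2
    have hju : j ∈ u := by rwa [hfu, ← hij, ← hfu]
    have : j ∈ J ∩ u := mem_inter.2 ⟨hj, hju⟩
    rw [huj, mem_singleton] at this
    exact hne this.symm
  have hsh : PseudoShatters F (J.image x) := by
    refine ⟨fun _ => z, fun T hT => ?_⟩
    obtain ⟨u, hu, huj⟩ := hJ (filter_subset (fun j => x j ∈ T) J)
    obtain ⟨f, hf, hfu⟩ := mem_superlevelTraces.1 hu
    refine ⟨f, hf, fun y hy => ?_⟩
    obtain ⟨j, hj, rfl⟩ := mem_image.1 hy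
    rw [← hfu]
    have := Finset.ext_iff.1 huj j
    simp only [mem_inter, mem_filter, hj, true_and] at this
    exact this
  rw [← card_image_of_injOn hinj]
  exact le_iSup₂ (f := fun (S : Finset X) (_ : PseudoShatters F S) => (#S : ℕ∞)) _ hsh

/-- Sauer–Shelah: a set family has at most as many members as it shatters sets, and those have size
at most `d`. -/
theorem log_card_superlevelTraces_le {X : Type*} {N d : ℕ} (hdN : d ≤ N) {F : Set (X → ℝ)}
    (hd : pdim F ≤ d) (x : Fin N → X) (z : ℝ) :
    Real.log (#(superlevelTraces F x z)) ≤ d * Real.log (Real.exp 1 * N / d) := by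
  refine le_trans ?_ (log_sum_choose_le hdN)
  rcases (superlevelTraces F x z).eq_empty_or_nonempty with h | h
  · rw [h]
    simpa using Real.log_natCast_nonneg (∑ k ∈ Iic d, N.choose k)
  refine Real.log_le_log (by exact_mod_cast h.card_pos) (Nat.cast_le.2 ?_)
  refine (card_le_card_shatterer _).trans (card_shatterer_le_sum_vcDim.trans ?_)
  rw [Fintype.card_fin]
  refine sum_le_sum_of_subset (Iic_subset_Iic.2 (Finset.sup_le fun J hJ => ?_))
  exact_mod_cast (card_le_pdim_of_shatters_superlevelTraces (mem_shatterer.1 hJ)).trans hd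

theorem intervalIntegrable_superlevel (v : ℝ) :
    IntervalIntegrable (fun z => if z ≤ v then (1 : ℝ) else -1) volume (-1) 1 := by
  refine (intervalIntegrable_const (c := (1 : ℝ))).mono_fun
    (Measurable.ite measurableSet_Iic measurable_const measurable_const).aestronglyMeasurable
    (Filter.Eventually.of_forall fun z => ?_)
  dsimp only
  split_ifs <;> simp

/-- This layer-cake identity passes from real values to signs, to which Massart's lemma applies at
each height `z`. -/
theorem integral_superlevel {v : ℝ} (hv : v ∈ Set.Icc (-1 : ℝ) 1) :
    ∫ z in (-1 : ℝ)..1, (if z ≤ v then (1 : ℝ) else -1) = 2 * v := by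
  have hi : ∀ {a b : ℝ}, a ∈ Set.Icc (-1 : ℝ) 1 → b ∈ Set.Icc (-1 : ℝ) 1 →
      IntervalIntegrable (fun z => if z ≤ v then (1 : ℝ) else -1) volume a b := fun ha hb =>
    (intervalIntegrable_superlevel v).mono_set (by
      rw [Set.uIcc_of_le (by norm_num : (-1 : ℝ) ≤ 1)]
      exact Set.uIcc_subset_Icc ha hb)
  rw [← intervalIntegral.integral_add_adjacent_intervals (b := v) (hi (by simp) hv) (hi hv (by simp))]
  have h1 : ∫ z in (-1 : ℝ)..v, (if z ≤ v then (1 : ℝ) else -1) = ∫ _z in (-1 : ℝ)..v, (1 : ℝ) := by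
    refine intervalIntegral.integral_congr fun z hz => ?_
    rw [Set.uIcc_of_le hv.1] at hz
    exact if_pos hz.2
  have h2 : ∫ z in v..1, (if z ≤ v then (1 : ℝ) else -1) = ∫ _z in v..1, (-1 : ℝ) := by
    refine intervalIntegral.integral_congr_ae (Filter.Eventually.of_forall fun z hz => ?_)
    rw [Set.uIoc_of_le hv.2] at hz
    exact if_neg (not_le.2 hz.1)
  rw [h1, h2]
  simp only [intervalIntegral.integral_const, smul_eq_mul]
  ring

/-- The empirical Rademacher complexity of a class of `[-1,1]`-valued functions is controlled by its
pseudo-dimension: selecting, for each choice of signs, a function from the class. -/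
theorem sum_signs_le_of_pdim_le {X : Type*} {N d : ℕ} (hN : 0 < N) (hdN : d ≤ N) {F : Set (X → ℝ)}
    (hd : pdim F ≤ d) (hF : ∀ f ∈ F, ∀ x, f x ∈ Set.Icc (-1 : ℝ) 1) (x : Fin N → X)
    (v : (Fin N → Bool) → X → ℝ) (hv : ∀ σ, v σ ∈ F) :
    ∑ σ : Fin N → Bool, ∑ j, boolSign (σ j) * v σ (x j)
      ≤ 2 ^ N * √(2 * N * (d * Real.log (Real.exp 1 * N / d))) := by
  have hi : ∀ (σ : Fin N → Bool) (j : Fin N), IntervalIntegrable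
      (fun z => boolSign (σ j) * (if z ≤ v σ (x j) then (1 : ℝ) else -1)) volume (-1) 1 := fun σ j =>
    (intervalIntegrable_superlevel _).const_mul _
  have hi' : ∀ σ : Fin N → Bool, IntervalIntegrable
      (fun z => ∑ j, boolSign (σ j) * (if z ≤ v σ (x j) then (1 : ℝ) else -1)) volume (-1) 1 :=
    fun σ => by simpa only [Finset.sum_fn] using IntervalIntegrable.sum univ fun j _ => hi σ j
  have hi'' : IntervalIntegrable (fun z => ∑ σ : Fin N → Bool, ∑ j,
      boolSign (σ j) * (if z ≤ v σ (x j) then (1 : ℝ) else -1)) volume (-1) 1 := by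
    simpa only [Finset.sum_fn] using IntervalIntegrable.sum univ fun σ _ => hi' σ
  have hI : ∫ z in (-1 : ℝ)..1, ∑ σ : Fin N → Bool, ∑ j,
        boolSign (σ j) * (if z ≤ v σ (x j) then (1 : ℝ) else -1)
      = 2 * ∑ σ : Fin N → Bool, ∑ j, boolSign (σ j) * v σ (x j) := by
    rw [intervalIntegral.integral_finsetSum fun σ _ => hi' σ,
      mul_sum]
    refine sum_congr rfl fun σ _ => ?_
    rw [intervalIntegral.integral_finsetSum fun j _ => hi σ j, mul_sum]
    refine sum_congr rfl fun j _ => ?_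
    rw [intervalIntegral.integral_const_mul, integral_superlevel (hF _ (hv σ) _)]
    ring
  -- At a fixed height, the superlevel sets of the selected functions are a selection from the
  -- traces. Integrating over `[-1,1]`, of length `2`, then cancels the factor `2` in `hI`.
  have hle : ∀ z : ℝ, ∑ σ : Fin N → Bool, ∑ j,
      boolSign (σ j) * (if z ≤ v σ (x j) then (1 : ℝ) else -1)
        ≤ 2 ^ N * √(2 * N * (d * Real.log (Real.exp 1 * N / d))) := by
    intro z
    have := sum_signs_le_of_log_card_le hN _ (log_card_superlevelTraces_le hdN hd x z)
      (fun σ => univ.filter fun j => z ≤ v σ (x j))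
      fun σ => mem_superlevelTraces.2 ⟨v σ, hv σ, by simp⟩
    simpa using this
  have := intervalIntegral.integral_mono_on (μ := volume) (by norm_num : (-1 : ℝ) ≤ 1)
    hi'' intervalIntegrable_const fun z _ => hle z
  rw [hI, intervalIntegral.integral_const, smul_eq_mul] at this
  linarith

end RademacherComplexity

/-! ### Uniform convergence by symmetrization and concentration. -/

section UniformConvergence

variable {Θ X : Type*} {N : ℕ}

/-- The largest amount, over the parameters `θ`, by which the mean of `φ θ` exceeds its average over
the sample `s`. -/
noncomputable def supDeviation [MeasurableSpace X] (μ : Measure X) (φ : Θ → X → ℝ)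
    (s : Fin N → X) : ℝ :=
  ⨆ θ, (∫ x, φ θ x ∂μ - 1 / (N : ℝ) * ∑ j, φ θ (s j))

/-- The largest difference, over the parameters `θ`, of the averages of `φ θ` over two samples. -/
noncomputable def supSampleDiff (φ : Θ → X → ℝ) (y : Fin N → X × X) : ℝ :=
  ⨆ θ, 1 / (N : ℝ) * ∑ j, (φ θ (y j).2 - φ θ (y j).1)

theorem abs_average_le {b : ℝ} (hN : 0 < N) {a : Fin N → ℝ} (ha : ∀ j, |a j| ≤ b) :
    |1 / (N : ℝ) * ∑ j, a j| ≤ b := by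
  have hN' : (0 : ℝ) < N := by exact_mod_cast hN
  rw [abs_mul, abs_of_nonneg (by positivity), one_div, inv_mul_le_iff₀ hN']
  refine (Finset.abs_sum_le_sum_abs _ _).trans ((Finset.sum_le_sum fun j _ => ha j).trans ?_)
  simp

theorem abs_integral_le_of_abs_le [MeasurableSpace X] (μ : Measure X) [IsProbabilityMeasure μ]
    {f : X → ℝ} {b : ℝ} (hf : ∀ x, |f x| ≤ b) : |∫ x, f x ∂μ| ≤ b := by
  simpa using norm_integral_le_of_norm_le_const (μ := μ) (f := f) (Filter.Eventually.of_forall hf)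

theorem abs_deviation_le [MeasurableSpace X] (μ : Measure X) [IsProbabilityMeasure μ]
    {f : X → ℝ} {b : ℝ} (hN : 0 < N) (hf : ∀ x, |f x| ≤ b) (s : Fin N → X) :
    |∫ x, f x ∂μ - 1 / (N : ℝ) * ∑ j, f (s j)| ≤ 2 * b :=
  (abs_sub _ _).trans (by
    linarith [abs_integral_le_of_abs_le μ hf, abs_average_le hN fun j => hf (s j)])

theorem abs_sampleDiff_le {f : X → ℝ} {b : ℝ} (hN : 0 < N) (hf : ∀ x, |f x| ≤ b)
    (y : Fin N → X × X) : |1 / (N : ℝ) * ∑ j, (f (y j).2 - f (y j).1)| ≤ 2 * b :=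
  abs_average_le hN fun j => (abs_sub _ _).trans (by linarith [hf (y j).1, hf (y j).2])

theorem bddAbove_range_of_abs_le {f : Θ → ℝ} {b : ℝ} (hf : ∀ θ, |f θ| ≤ b) :
    BddAbove (Set.range f) :=
  ⟨b, by rintro _ ⟨θ, rfl⟩; exact (abs_le.1 (hf θ)).2⟩

theorem abs_ciSup_le [Nonempty Θ] {f : Θ → ℝ} {b : ℝ} (hf : ∀ θ, |f θ| ≤ b) :
    |⨆ θ, f θ| ≤ b := by
  obtain ⟨θ⟩ := ‹Nonempty Θ›
  have : Nonempty Θ := ⟨θ⟩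
  exact abs_le.2 ⟨(abs_le.1 (hf θ)).1.trans (le_ciSup (bddAbove_range_of_abs_le hf) θ),
    ciSup_le fun θ => (abs_le.1 (hf θ)).2⟩

theorem ciSup_sub_ciSup_le [Nonempty Θ] {f g : Θ → ℝ} {c : ℝ} (hg : BddAbove (Set.range g))
    (h : ∀ θ, f θ - g θ ≤ c) : (⨆ θ, f θ) - ⨆ θ, g θ ≤ c := by
  rw [sub_le_iff_le_add]
  refine ciSup_le fun θ => ?_
  linarith [h θ, le_ciSup hg θ]

theorem average_sub_average_update_le {b : ℝ} {f : X → ℝ} (hf : ∀ x, |f x| ≤ b)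
    (s : Fin N → X) (j : Fin N) (x : X) :
    |1 / (N : ℝ) * ∑ l, f (s l) - 1 / (N : ℝ) * ∑ l, f (Function.update s j x l)| ≤ 2 * b / N := by
  have h : ∑ l, f (s l) - ∑ l, f (Function.update s j x l) = f (s j) - f x := by
    rw [← Finset.sum_sub_distrib, Finset.sum_eq_single j]
    · simp
    · intro l _ hl
      simp [Function.update_of_ne hl]
    · simp
  rw [← mul_sub, h, abs_mul, abs_of_nonneg (by positivity), one_div, div_eq_inv_mul]
  gcongr
  exact (abs_sub _ _).trans (by linarith [hf (s j), hf x])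

/-- Exchanging the two components at the indices where `σ` is `false`. -/
def swapAt (σ : Fin N → Bool) (y : Fin N → X × X) : Fin N → X × X :=
  fun j => if σ j then y j else (y j).swap

/-- The two components of each pair are independent with the same law, so exchanging them is
invisible to the measure. -/
theorem measurePreserving_swapAt [MeasurableSpace X] (μ : Measure X) [IsProbabilityMeasure μ]
    (σ : Fin N → Bool) :
    MeasurePreserving (swapAt (X := X) σ) (Measure.pi fun _ => μ.prod μ)
      (Measure.pi fun _ => μ.prod μ) := by
  refine measurePreserving_pi (f := fun j (p : X × X) => if σ j then p else p.swap) _ _ fun j => ?_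
  cases σ j
  · simpa using! (Measure.measurePreserving_swap (μ := μ) (ν := μ))
  · simpa using! MeasurePreserving.id (μ.prod μ)

theorem sampleDiff_swapAt (φ : Θ → X → ℝ) (θ : Θ) (σ : Fin N → Bool) (y : Fin N → X × X) :
    ∑ j, (φ θ (swapAt σ y j).2 - φ θ (swapAt σ y j).1)
      = ∑ j, boolSign (σ j) * (φ θ (y j).2 - φ θ (y j).1) := by
  refine Finset.sum_congr rfl fun j _ => ?_
  unfold swapAt boolSign
  split_ifs <;> simp

/-- The suprema need not be attained: a parameter within `η / 2 ^ N` of the supremum is selected for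
each sign pattern, for a total loss of `η`. Hence `hB` speaks of selections `ψ`, and no
measurability is asked of them. -/
theorem sum_supSampleDiff_swapAt_le [Nonempty Θ] {φ : Θ → X → ℝ} {B : ℝ} {y : Fin N → X × X}
    (hB : ∀ ψ : (Fin N → Bool) → Θ, ∑ σ, 1 / (N : ℝ) *
      ∑ j, boolSign (σ j) * (φ (ψ σ) (y j).2 - φ (ψ σ) (y j).1) ≤ 2 ^ N * B) :
    ∑ σ, supSampleDiff φ (swapAt σ y) ≤ 2 ^ N * B := by
  refine le_of_forall_pos_le_add fun η hη => ?_
  have hsel : ∀ σ : Fin N → Bool, ∃ θ, supSampleDiff φ (swapAt σ y) - η / 2 ^ N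
      < 1 / (N : ℝ) * ∑ j, boolSign (σ j) * (φ θ (y j).2 - φ θ (y j).1) := fun σ => by
    obtain ⟨θ, hθ⟩ := exists_lt_of_lt_ciSup
      (sub_lt_self (supSampleDiff φ (swapAt σ y)) (by positivity : 0 < η / 2 ^ N))
    exact ⟨θ, by rwa [sampleDiff_swapAt] at hθ⟩
  choose ψ hψ using hsel
  calc ∑ σ, supSampleDiff φ (swapAt σ y)
      ≤ ∑ σ, (1 / (N : ℝ) * ∑ j, boolSign (σ j) * (φ (ψ σ) (y j).2 - φ (ψ σ) (y j).1)
          + η / 2 ^ N) := Finset.sum_le_sum fun σ _ => by linarith [hψ σ]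
    _ ≤ 2 ^ N * B + η := by
        rw [Finset.sum_add_distrib]
        refine add_le_add (hB ψ) (le_of_eq ?_)
        simp
        field_simp

variable [MeasurableSpace Θ] [StandardBorelSpace Θ] [Nonempty Θ] [MeasurableSpace X]
  [StandardBorelSpace X] (μ : Measure X) [IsProbabilityMeasure μ] {φ : Θ → X → ℝ} {b : ℝ}

theorem aemeasurable_supDeviation (hN : 0 < N) (hφ : Measurable (Function.uncurry φ))
    (hb : ∀ θ x, |φ θ x| ≤ b) :
    AEMeasurable (supDeviation (N := N) μ φ) (Measure.pi fun _ => μ) := by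
  refine aemeasurable_iSup_param (Θ := Θ) _ ?_
    fun s => bddAbove_range_of_abs_le fun θ => abs_deviation_le μ hN (hb θ) s
  have h1 : Measurable fun θ => ∫ x, φ θ x ∂μ :=
    (StronglyMeasurable.integral_prod_right hφ.stronglyMeasurable).measurable
  refine (h1.comp measurable_fst).sub (measurable_const.mul (Finset.measurable_sum _ fun j _ => ?_))
  exact hφ.comp (measurable_fst.prodMk ((measurable_pi_apply j).comp measurable_snd))

theorem aemeasurable_supSampleDiff (hN : 0 < N) (hφ : Measurable (Function.uncurry φ))
    (hb : ∀ θ x, |φ θ x| ≤ b) :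
    AEMeasurable (supSampleDiff (N := N) φ) (Measure.pi fun _ => μ.prod μ) := by
  refine aemeasurable_iSup_param (Θ := Θ) _ ?_
    fun y => bddAbove_range_of_abs_le fun θ => abs_sampleDiff_le hN (hb θ) y
  refine measurable_const.mul (Finset.measurable_sum _ fun j _ => ?_)
  have hj : Measurable fun p : Θ × (Fin N → X × X) => p.2 j :=
    (measurable_pi_apply j).comp measurable_snd
  exact (hφ.comp (measurable_fst.prodMk hj.snd)).sub (hφ.comp (measurable_fst.prodMk hj.fst))

/-- Ghost sample: the mean of `φ θ` is the expected average over a second independent sample, and a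
supremum of integrals is at most the integral of the supremum. -/
theorem integral_supDeviation_le_integral_supSampleDiff (hN : 0 < N)
    (hφ : Measurable (Function.uncurry φ)) (hb : ∀ θ x, |φ θ x| ≤ b) :
    ∫ s, supDeviation (N := N) μ φ s ∂Measure.pi (fun _ => μ)
      ≤ ∫ y, supSampleDiff (N := N) φ y ∂Measure.pi (fun _ => μ.prod μ) := by
  set ρ : Measure (Fin N → X) := Measure.pi fun _ => μ
  have hmp : MeasurePreserving (MeasurableEquiv.arrowProdEquivProdArrow X X (Fin N)).symm
      (ρ.prod ρ) (Measure.pi fun _ => μ.prod μ) :=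
    (measurePreserving_arrowProdEquivProdArrow X X (Fin N) (fun _ => μ) fun _ => μ).symm _
  set H : (Fin N → X) × (Fin N → X) → ℝ := fun p => supSampleDiff φ fun j => (p.1 j, p.2 j)
  have hH : H = supSampleDiff φ ∘ (MeasurableEquiv.arrowProdEquivProdArrow X X (Fin N)).symm := rfl
  have hHm : AEStronglyMeasurable H (ρ.prod ρ) := by
    rw [hH]
    exact ((aemeasurable_supSampleDiff μ hN hφ hb).comp_quasiMeasurePreserving
      hmp.quasiMeasurePreserving).aestronglyMeasurable
  have hHb : ∀ p, |H p| ≤ 2 * b := fun p => abs_ciSup_le fun θ => abs_sampleDiff_le hN (hb θ) _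
  have hHi : Integrable H (ρ.prod ρ) := Integrable.of_bound hHm _ (Filter.Eventually.of_forall hHb)
  rw [← hmp.integral_comp', show (∫ p, supSampleDiff φ
    ((MeasurableEquiv.arrowProdEquivProdArrow X X (Fin N)).symm p) ∂ρ.prod ρ) = ∫ p, H p ∂ρ.prod ρ
    from rfl, integral_prod H hHi]
  refine integral_mono_ae (Integrable.of_bound
    (aemeasurable_supDeviation μ hN hφ hb).aestronglyMeasurable (2 * b)
    (Filter.Eventually.of_forall fun s => abs_ciSup_le fun θ => abs_deviation_le μ hN (hb θ) s))
    hHi.integral_prod_left ?_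
  filter_upwards [hHm.prodMk_left] with s hs
  refine ciSup_le fun θ => ?_
  have hφi : Integrable (φ θ) μ := Integrable.of_bound
    (hφ.comp measurable_prodMk_left).aestronglyMeasurable b (Filter.Eventually.of_forall (hb θ))
  have hev : ∀ j : Fin N, Integrable (fun s' : Fin N → X => φ θ (s' j)) ρ := fun j =>
    (measurePreserving_eval (fun _ : Fin N => μ) j).integrable_comp_of_integrable hφi
  have hev' : ∀ j : Fin N, ∫ s', φ θ (s' j) ∂ρ = ∫ x, φ θ x ∂μ := fun j => by
    have hm := measurePreserving_eval (fun _ : Fin N => μ) j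
    rw [← hm.map_eq, integral_map hm.measurable.aemeasurable (hm.map_eq.symm ▸ hφi.1)]
  have hN' : (N : ℝ) ≠ 0 := by exact_mod_cast hN.ne'
  have hd : ∀ j : Fin N, Integrable (fun s' : Fin N → X => φ θ (s' j) - φ θ (s j)) ρ := fun j =>
    (hev j).sub (integrable_const _)
  have hsum : Integrable (fun s' : Fin N → X => ∑ j, (φ θ (s' j) - φ θ (s j))) ρ :=
    integrable_finsetSum _ fun j _ => hd j
  have : ∫ x, φ θ x ∂μ - 1 / (N : ℝ) * ∑ j, φ θ (s j)
      = ∫ s', 1 / (N : ℝ) * ∑ j, (φ θ (s' j) - φ θ (s j)) ∂ρ := by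
    rw [integral_const_mul, integral_finsetSum _ fun j _ => hd j]
    simp only [integral_sub (hev _) (integrable_const _), hev', integral_const, probReal_univ,
      one_smul, Finset.sum_sub_distrib, Finset.sum_const, Finset.card_univ, Fintype.card_fin,
      nsmul_eq_mul]
    rw [mul_sub, ← mul_assoc, one_div_mul_cancel hN', one_mul]
  rw [this]
  refine integral_mono (hsum.const_mul _) (Integrable.of_bound hs (2 * b)
    (Filter.Eventually.of_forall fun s' => hHb (s, s'))) fun s' => ?_
  exact le_ciSup (f := fun θ => 1 / (N : ℝ) * ∑ j, (φ θ (s' j) - φ θ (s j)))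
    (bddAbove_range_of_abs_le fun θ => abs_sampleDiff_le hN (hb θ) fun j => (s j, s' j)) θ

/-- **Symmetrization**. -/
theorem integral_supDeviation_le (hN : 0 < N) (hφ : Measurable (Function.uncurry φ))
    (hb : ∀ θ x, |φ θ x| ≤ b) {B : ℝ}
    (hB : ∀ (y : Fin N → X × X) (ψ : (Fin N → Bool) → Θ), ∑ σ, 1 / (N : ℝ) *
      ∑ j, boolSign (σ j) * (φ (ψ σ) (y j).2 - φ (ψ σ) (y j).1) ≤ 2 ^ N * B) :
    ∫ s, supDeviation (N := N) μ φ s ∂Measure.pi (fun _ => μ) ≤ B := by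
  refine (integral_supDeviation_le_integral_supSampleDiff μ hN hφ hb).trans ?_
  set κ : Measure (Fin N → X × X) := Measure.pi fun _ => μ.prod μ
  have hm := aemeasurable_supSampleDiff (N := N) μ hN hφ hb
  have hswap : ∀ σ : Fin N → Bool, AEMeasurable (fun y => supSampleDiff φ (swapAt σ y)) κ :=
    fun σ => hm.comp_quasiMeasurePreserving (measurePreserving_swapAt μ σ).quasiMeasurePreserving
  -- Every swap leaves the integral unchanged, so it equals its average over all sign patterns, and
  -- that average is bounded pointwise.
  have hint : ∀ σ : Fin N → Bool, ∫ y, supSampleDiff φ (swapAt σ y) ∂κ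
      = ∫ y, supSampleDiff φ y ∂κ := fun σ => by
    have hT : MeasurePreserving (swapAt σ) κ κ := measurePreserving_swapAt μ σ
    conv_rhs => rw [← hT.map_eq]
    rw [integral_map hT.measurable.aemeasurable (hT.map_eq.symm ▸ hm.aestronglyMeasurable)]
  have hi : ∀ σ : Fin N → Bool, Integrable (fun y => supSampleDiff φ (swapAt σ y)) κ := fun σ =>
    Integrable.of_bound (hswap σ).aestronglyMeasurable (2 * b)
      (Filter.Eventually.of_forall fun y => abs_ciSup_le fun θ => abs_sampleDiff_le hN (hb θ) _)
  have hsum : ∫ y, ∑ σ : Fin N → Bool, supSampleDiff φ (swapAt σ y) ∂κ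
      = 2 ^ N * ∫ y, supSampleDiff φ y ∂κ := by
    rw [integral_finsetSum _ fun σ _ => hi σ]
    simp [hint]
  have hle := integral_mono (μ := κ) (integrable_finsetSum Finset.univ fun σ _ => hi σ)
    (integrable_const (2 ^ N * B)) fun y => sum_supSampleDiff_swapAt_le (hB y)
  rw [hsum, integral_const, probReal_univ, one_smul] at hle
  exact le_of_mul_le_mul_left hle (by positivity)

/-- Uniform convergence: with high probability over the sample, for every parameter, the mean exceeds
the sample average by little more than the expectation of the largest deviation. -/
theorem measure_exists_deviation_le (hN : 0 < N) (hφ : Measurable (Function.uncurry φ))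
    (hb0 : 0 ≤ b) (hb : ∀ θ x, |φ θ x| ≤ b) {B ε : ℝ} (hε : 0 ≤ ε)
    (hB : ∀ (y : Fin N → X × X) (ψ : (Fin N → Bool) → Θ), ∑ σ, 1 / (N : ℝ) *
      ∑ j, boolSign (σ j) * (φ (ψ σ) (y j).2 - φ (ψ σ) (y j).1) ≤ 2 ^ N * B) :
    Measure.pi (fun _ : Fin N => μ)
        {s | ∃ θ, B + ε < ∫ x, φ θ x ∂μ - 1 / (N : ℝ) * ∑ j, φ θ (s j)}
      ≤ ENNReal.ofReal (Real.exp (-(ε ^ 2 * N / (2 * b ^ 2)))) := by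
  -- Replacing one sample point moves each average by at most `2 * b / N`, so the variance proxy is
  -- `N * (b / N) ^ 2 = b ^ 2 / N`.
  have hsub := hasSubgaussianMGF_of_boundedDifferences μ (c := Real.toNNReal (2 * b / N)) (C := 2 * b)
    (aemeasurable_supDeviation (N := N) μ hN hφ hb)
    (fun s => abs_ciSup_le fun θ => abs_deviation_le μ hN (hb θ) s) (fun s j x => by
      have h0 : (0 : ℝ) ≤ 2 * b / N := by positivity
      rw [Real.coe_toNNReal _ h0, abs_sub_le_iff]
      have hbd := fun s : Fin N → X =>
        bddAbove_range_of_abs_le fun θ => abs_deviation_le μ hN (hb θ) s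
      constructor
      · refine ciSup_sub_ciSup_le (hbd _) fun θ => ?_
        have := (abs_le.1 (average_sub_average_update_le (hb θ) s j x)).1
        linarith
      · refine ciSup_sub_ciSup_le (hbd _) fun θ => ?_
        have := (abs_le.1 (average_sub_average_update_le (hb θ) s j x)).2
        linarith)
  have hE := integral_supDeviation_le μ hN hφ hb hB
  have htail := hsub.measure_ge_le hε
  rw [← ENNReal.ofReal_toReal (measure_ne_top (Measure.pi fun _ : Fin N => μ) _)]
  refine ENNReal.ofReal_le_ofReal (le_trans (measureReal_mono ?_) (htail.trans (le_of_eq ?_)))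
  · rintro s ⟨θ, hθ⟩
    have := le_ciSup (bddAbove_range_of_abs_le fun θ => abs_deviation_le μ hN (hb θ) s) θ
    change _ ≤ supDeviation μ φ s at this
    change ε ≤ supDeviation μ φ s - _
    linarith
  · have h0 : (0 : ℝ) ≤ 2 * b / N := by positivity
    have hN' : (N : ℝ) ≠ 0 := by exact_mod_cast hN.ne'
    push_cast
    rw [Real.coe_toNNReal _ h0]
    congr 1
    -- For `b = 0` both exponents are divisions by zero, hence `0`.
    rcases hb0.eq_or_lt with rfl | hbpos
    · simp
    · field_simp

end UniformConvergence

/-! ### Dispersion on the sample, and uniform convergence for the gains. -/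

namespace ApproxIC

theorem l1dist_nonneg {m : ℕ} (x y : Cube m) : 0 ≤ l1dist x y :=
  Finset.sum_nonneg fun _ _ => abs_nonneg _

theorem l1dist_self {m : ℕ} (x : Cube m) : l1dist x x = 0 := by
  simp [l1dist]

/-- For piecewise Lipschitz and dispersed functions, moving the argument by at most `w` changes the
average little. -/
theorem PiecewiseLipschitzDispersed.average_sub_le {m N : ℕ} (hN : 0 < N) {L w k : ℝ} (hL : 0 ≤ L)
    {f : Fin N → Cube m → ℝ} (hf : PiecewiseLipschitzDispersed L w k f) (hb : ∀ j q, |f j q| ≤ 1)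
    {p q : Cube m} (hpq : l1dist p q ≤ w) :
    |1 / (N : ℝ) * ∑ j, (f j p - f j q)| ≤ L * w + 2 * k / N := by
  classical
  obtain ⟨Q, hQ, hk⟩ := hf
  have hN' : (0 : ℝ) < N := by exact_mod_cast hN
  have hw : 0 ≤ w := (l1dist_nonneg p q).trans hpq
  set D : Set (Fin N) := {j | Splits (Q j) {q | l1dist p q ≤ w}}
  -- If the ball around `p` is not split, `p` and `q` share a part and the Lipschitz bound applies.
  -- Otherwise the range `[-1,1]` gives `2`, and this happens for at most `k` indices.
  have hterm : ∀ j, |f j p - f j q| ≤ L * w + if j ∈ D then 2 else 0 := by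
    intro j
    split_ifs with hj
    · have : |f j p - f j q| ≤ 2 := (abs_sub _ _).trans (by linarith [hb j p, hb j q])
      linarith [mul_nonneg hL hw]
    · have hQj : Q j p q := by
        by_contra h
        exact hj ⟨p, by simpa [l1dist_self] using hw, q, hpq, h⟩
      have := mul_le_mul_of_nonneg_left hpq hL
      linarith [hQ j p q hQj]
  have hcard : ∑ j, (if j ∈ D then (2 : ℝ) else 0) ≤ 2 * k := by
    have h := hk p
    change ((D.ncard : ℕ) : ℝ) ≤ k at h
    rw [Set.ncard_eq_toFinset_card'] at h
    rw [← Finset.sum_filter, Finset.sum_const, nsmul_eq_mul, mul_comm]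
    have e : (Finset.univ.filter fun j => j ∈ D) = D.toFinset := by
      ext j
      simp
    rw [e]
    linarith
  rw [abs_mul, abs_of_nonneg (by positivity), one_div, inv_mul_le_iff₀ hN']
  refine (Finset.abs_sum_le_sum_abs _ _).trans ((Finset.sum_le_sum fun j _ => hterm j).trans ?_)
  rw [Finset.sum_add_distrib]
  have : (N : ℝ) * (L * w + 2 * k / N) = N * (L * w) + 2 * k := by field_simp
  rw [this]
  simpa using hcard

section Mechanisms

variable {𝓜 : Type*} {n m N : ℕ} {u : 𝓜 → Fin n → (Fin n → Cube m) → (Fin n → Cube m) → ℝ}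

theorem util_mem_Icc (hu : ∀ M i θ θ', u M i θ θ' ∈ Set.Icc (-1 : ℝ) 1) (i : Fin n) (M : 𝓜)
    (t r : Cube m) (x : Others n m i) : util u i M t r x ∈ Set.Icc (-1 : ℝ) 1 :=
  hu _ _ _ _

theorem abs_util_le (hu : ∀ M i θ θ', u M i θ θ' ∈ Set.Icc (-1 : ℝ) 1) (i : Fin n) (M : 𝓜)
    (t r : Cube m) (x : Others n m i) : |util u i M t r x| ≤ 1 :=
  abs_le.2 (util_mem_Icc hu i M t r x)

/-- Under dispersion, the empirical gain from any misreport is at most the largest empirical gain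
over the grid, plus an error term. -/
theorem empGain_le_of_dispersionHolds (hu : ∀ M i θ θ', u M i θ θ' ∈ Set.Icc (-1 : ℝ) 1)
    (hN : 0 < N) {L w k : Fin n → ℝ} {s : ∀ i : Fin n, Fin N → Others n m i} {i : Fin n}
    (hL : 0 ≤ L i) (hD : DispersionHolds u L w k s) {G : Finset (Cube m)} (hG : IsGrid (w i) G)
    (M : 𝓜) (t r : Cube m) :
    empGain u i (s i) M t r
      ≤ (⨆ p : G × G, empGain u i (s i) M p.1 p.2) + 4 * L i * w i + 8 * k i / N := by
  obtain ⟨p, hp, htp⟩ := hG t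
  obtain ⟨q, hq, hrq⟩ := hG r
  obtain ⟨hrep, htrue⟩ := hD M i
  -- Four moves, each costing `L * w + 2 * k / N`: (true type, report) goes from `(t, r)` through
  -- `(p, r)` to `(p, q)`, and from `(t, t)` through `(p, t)` to `(p, p)`.
  have h1 := (abs_le.1 ((htrue r).average_sub_le hN hL (fun j _ => abs_util_le hu i M _ _ _) htp)).2
  have h2 := (abs_le.1 ((hrep p).average_sub_le hN hL (fun j _ => abs_util_le hu i M _ _ _) hrq)).2
  have h3 := (abs_le.1 ((htrue t).average_sub_le hN hL (fun j _ => abs_util_le hu i M _ _ _) htp)).1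
  have h4 := (abs_le.1 ((hrep p).average_sub_le hN hL (fun j _ => abs_util_le hu i M _ _ _) htp)).1
  have hsup : empGain u i (s i) M p q ≤ ⨆ p : G × G, empGain u i (s i) M p.1 p.2 :=
    le_ciSup (f := fun p : G × G => empGain u i (s i) M p.1 p.2) (Set.finite_range _).bddAbove
      (⟨p, hp⟩, ⟨q, hq⟩)
  have e : 8 * k i / N = 4 * (2 * k i / N) := by ring
  rw [e]
  simp only [empGain, Finset.sum_sub_distrib, mul_sub] at *
  linarith

/-- Flipping all signs permutes the sign patterns. This handles the utilities that enter the
symmetrized gain with a minus sign. -/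
theorem sum_signs_neg_le_of_pdim_le {X : Type*} {d : ℕ} (hN : 0 < N) (hdN : d ≤ N) {F : Set (X → ℝ)}
    (hd : pdim F ≤ d) (hF : ∀ f ∈ F, ∀ x, f x ∈ Set.Icc (-1 : ℝ) 1) (x : Fin N → X)
    (v : (Fin N → Bool) → X → ℝ) (hv : ∀ σ, v σ ∈ F) :
    -∑ σ : Fin N → Bool, ∑ j, boolSign (σ j) * v σ (x j)
      ≤ 2 ^ N * √(2 * N * (d * Real.log (Real.exp 1 * N / d))) := by
  let e : (Fin N → Bool) ≃ (Fin N → Bool) := Equiv.arrowCongr (Equiv.refl _) Equiv.boolNot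
  have he : ∀ σ j, e σ j = !σ j := fun _ _ => rfl
  have h := sum_signs_le_of_pdim_le hN hdN hd hF x (fun σ => v (e σ)) fun σ => hv _
  refine le_trans (le_of_eq ?_) h
  rw [← Equiv.sum_comp e, ← Finset.sum_neg_distrib]
  refine Finset.sum_congr rfl fun σ _ => ?_
  rw [← Finset.sum_neg_distrib]
  refine Finset.sum_congr rfl fun j _ => ?_
  rw [he]
  cases σ j <;> simp [boolSign]

/-- The symmetrized gains, with the mechanism and the types selected for each choice of signs. -/
theorem sum_signs_gain_le (hu : ∀ M i θ θ', u M i θ θ' ∈ Set.Icc (-1 : ℝ) 1) {i : Fin n} {d : ℕ}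
    (hd : pdim (utilClass u i) ≤ d) (hN : 0 < N) (hdN : d ≤ N)
    (y : Fin N → Others n m i × Others n m i) (ψ : (Fin N → Bool) → 𝓜 × Cube m × Cube m) :
    ∑ σ, 1 / (N : ℝ) * ∑ j, boolSign (σ j) *
        ((util u i (ψ σ).1 (ψ σ).2.1 (ψ σ).2.2 (y j).2 - util u i (ψ σ).1 (ψ σ).2.1 (ψ σ).2.1 (y j).2)
        - (util u i (ψ σ).1 (ψ σ).2.1 (ψ σ).2.2 (y j).1
          - util u i (ψ σ).1 (ψ σ).2.1 (ψ σ).2.1 (y j).1))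
      ≤ 2 ^ N * (4 * √(2 * d / N * Real.log (Real.exp 1 * N / d))) := by
  have hN' : (0 : ℝ) < N := by exact_mod_cast hN
  have hF : ∀ f ∈ utilClass u i, ∀ x, f x ∈ Set.Icc (-1 : ℝ) 1 := by
    rintro _ ⟨M, t, r, rfl⟩ x
    exact util_mem_Icc hu i M t r x
  have hr : ∀ σ, util u i (ψ σ).1 (ψ σ).2.1 (ψ σ).2.2 ∈ utilClass u i := fun σ => ⟨_, _, _, rfl⟩
  have ht : ∀ σ, util u i (ψ σ).1 (ψ σ).2.1 (ψ σ).2.1 ∈ utilClass u i := fun σ => ⟨_, _, _, rfl⟩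
  -- The gain is split into its utilities at `r` and at `t`, on each of the two samples. The four
  -- sums account for the factor `4`, and only the pseudo-dimension of the utilities themselves is
  -- used, not that of their differences.
  have h1 := sum_signs_le_of_pdim_le hN hdN hd hF (fun j => (y j).2) _ hr
  have h2 := sum_signs_neg_le_of_pdim_le hN hdN hd hF (fun j => (y j).2) _ ht
  have h3 := sum_signs_neg_le_of_pdim_le hN hdN hd hF (fun j => (y j).1) _ hr
  have h4 := sum_signs_le_of_pdim_le hN hdN hd hF (fun j => (y j).1) _ ht
  have hsq : √(2 * N * (d * Real.log (Real.exp 1 * N / d)))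
      = N * √(2 * d / N * Real.log (Real.exp 1 * N / d)) := by
    have : 2 * N * (d * Real.log (Real.exp 1 * N / d))
        = (N : ℝ) ^ 2 * (2 * d / N * Real.log (Real.exp 1 * N / d)) := by field_simp
    rw [this, Real.sqrt_mul (by positivity), Real.sqrt_sq hN'.le]
  rw [hsq] at h1 h2 h3 h4
  rw [← Finset.mul_sum, one_div, inv_mul_le_iff₀ hN']
  simp only [mul_sub, Finset.sum_sub_distrib]
  linarith

instance isProbabilityMeasure_othersLaw (ν : Fin n → Measure (Cube m))
    [∀ i, IsProbabilityMeasure (ν i)] (i : Fin n) : IsProbabilityMeasure (othersLaw ν i) := by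
  unfold othersLaw
  infer_instance

/-- With high probability over the sample, every expected gain of agent `i` is at most the empirical
gain plus the estimation error. -/
theorem measure_exists_expGain_gt_le [MeasurableSpace 𝓜] [StandardBorelSpace 𝓜]
    (hu : ∀ M i θ θ', u M i θ θ' ∈ Set.Icc (-1 : ℝ) 1) {i : Fin n}
    (hmeas : Measurable fun q : 𝓜 × Cube m × Cube m × Others n m i =>
      util u i q.1 q.2.1 q.2.2.1 q.2.2.2)
    (ν : Fin n → Measure (Cube m)) [∀ i, IsProbabilityMeasure (ν i)] {d : ℕ}
    (hd : pdim (utilClass u i) ≤ d) (hN : 0 < N) (hdN : d ≤ N) {δ : ℝ} (hδ : 0 < δ)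
    (hδn : δ ≤ 2 * n) :
    Measure.pi (fun _ : Fin N => othersLaw ν i)
        {s | ∃ M t r, empGain u i s M t r + estError n N δ d < expGain u ν i M t r}
      ≤ ENNReal.ofReal (δ / (2 * n)) := by
  rcases isEmpty_or_nonempty 𝓜 with h | h
  · simp
  have hN' : (0 : ℝ) < N := by exact_mod_cast hN
  have hn : (0 : ℝ) < 2 * n := hδ.trans_le hδn
  have hlog : 0 ≤ Real.log (2 * n / δ) := Real.log_nonneg ((one_le_div hδ).2 hδn)
  let φ : 𝓜 × Cube m × Cube m → Others n m i → ℝ := fun θ x =>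
    util u i θ.1 θ.2.1 θ.2.2 x - util u i θ.1 θ.2.1 θ.2.1 x
  have hφ : Measurable (Function.uncurry φ) := by
    refine Measurable.sub ?_ ?_
    · exact hmeas.comp (measurable_fst.fst.prodMk
        (measurable_fst.snd.fst.prodMk (measurable_fst.snd.snd.prodMk measurable_snd)))
    · exact hmeas.comp (measurable_fst.fst.prodMk
        (measurable_fst.snd.fst.prodMk (measurable_fst.snd.fst.prodMk measurable_snd)))
  have hb : ∀ θ x, |φ θ x| ≤ 2 := fun θ x => (abs_sub _ _).trans (by
    linarith [abs_util_le hu i θ.1 θ.2.1 θ.2.2 x, abs_util_le hu i θ.1 θ.2.1 θ.2.1 x])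
  -- Gains are bounded by `b = 2`, and `ε` is chosen so that `ε ^ 2 * N / (2 * b ^ 2) = log (2 * n /
  -- δ)`; the tail is then `δ / (2 * n)`.
  have hmain := measure_exists_deviation_le (othersLaw ν i) hN hφ zero_le_two hb
    (ε := 4 * √(1 / (2 * N) * Real.log (2 * n / δ))) (by positivity)
    fun y ψ => sum_signs_gain_le hu hd hN hdN y ψ
  refine (measure_mono ?_).trans (hmain.trans (le_of_eq ?_))
  · rintro s ⟨M, t, r, hs⟩
    refine ⟨(M, t, r), ?_⟩
    simp only [estError, empGain, expGain] at hs
    simp only [φ]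
    linarith
  · congr 1
    rw [mul_pow, Real.sq_sqrt (by positivity)]
    have : 4 ^ 2 * (1 / (2 * N) * Real.log (2 * n / δ)) * N / (2 * 2 ^ 2) = Real.log (2 * n / δ) := by
      field_simp
      norm_num
    rw [this, Real.exp_neg, Real.exp_log (by positivity), inv_div]

end Mechanisms

end ApproxIC

/-! ### From laws to events, and the final union bound. -/

/-- The set `B` may fail to be measurable; passing to a measurable hull of the same measure gives
the inequality for outer measures. -/
theorem ProbabilityTheory.HasLaw.measure_setOf_mem_le {Ω X : Type*} [MeasurableSpace Ω] [MeasurableSpace X]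
    {P : Measure Ω} {ρ : Measure X} {S : Ω → X} (hS : HasLaw S ρ P) (B : Set X) :
    P {ω | S ω ∈ B} ≤ ρ B := by
  rw [← measure_toMeasurable B, ← hS.map_eq,
    Measure.map_apply_of_aemeasurable hS.aemeasurable (measurableSet_toMeasurable _ _)]
  exact measure_mono fun ω hω => subset_toMeasurable _ B hω

theorem mainTheorem3
    -- a class of mechanisms for `n` agents with type spaces `[0,1]^m`, and their utilities
    {𝓜 : Type*} [MeasurableSpace 𝓜] [StandardBorelSpace 𝓜] {n m N : ℕ}
    (u : 𝓜 → Fin n → (Fin n → Cube m) → (Fin n → Cube m) → ℝ)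
    (hu : ∀ M i θ θ', u M i θ θ' ∈ Set.Icc (-1 : ℝ) 1)
    (hmeas : ∀ i, Measurable fun q : 𝓜 × Cube m × Cube m × Others n m i =>
      util u i q.1 q.2.1 q.2.2.1 q.2.2.2)
    -- the agents' types are independent
    (ν : Fin n → Measure (Cube m)) [∀ i, IsProbabilityMeasure (ν i)]
    -- for each agent `i`, a sequence `S i` of `N` independent samples of the others' types;
    -- nothing is assumed on how the sequences of different agents depend on each other
    {Ω : Type*} [MeasurableSpace Ω] (P : Measure Ω) [IsProbabilityMeasure P]
    (S : ∀ i : Fin n, Ω → Fin N → Others n m i)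
    (hS : ∀ i, HasLaw (S i) (Measure.pi fun _ : Fin N => othersLaw ν i) P)
    (d : Fin n → ℕ) (hd : ∀ i, pdim (utilClass u i) = d i)
    (hN : 1 ≤ N) (hdN : ∀ i, d i ≤ N)
    (δ : ℝ) (hδ : 0 < δ) :
    -- "with probability at least `1 - c`" is stated as: the complement has outer measure at most `c`
    -- if dispersion holds with probability `1 - δ`, then the bound holds with probability `1 - 2δ`
    (∀ (L w k : Fin n → ℝ) (G : Fin n → Finset (Cube m)),
      (∀ i, 0 ≤ L i) → (∀ i, IsGrid (w i) (G i)) →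
      P {ω | ¬ DispersionHolds u L w k fun i => S i ω} ≤ ENNReal.ofReal δ →
      P {ω | ¬ GapBound u ν δ d L w k G fun i => S i ω} ≤ ENNReal.ofReal (2 * δ)) ∧
    -- with probability `1 - δ`, the bound holds for all parameters for which the drawn samples
    -- satisfy the dispersion conditions
    P {ω | ¬ ∀ (L w k : Fin n → ℝ) (G : Fin n → Finset (Cube m)),
      (∀ i, 0 ≤ L i) → (∀ i, IsGrid (w i) (G i)) →
      (DispersionHolds u L w k fun i => S i ω) →
      GapBound u ν δ d L w k G fun i => S i ω} ≤ ENNReal.ofReal δ := by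
  have hpart2 : P {ω | ¬ ∀ (L w k : Fin n → ℝ) (G : Fin n → Finset (Cube m)),
      (∀ i, 0 ≤ L i) → (∀ i, IsGrid (w i) (G i)) →
      (DispersionHolds u L w k fun i => S i ω) →
      GapBound u ν δ d L w k G fun i => S i ω} ≤ ENNReal.ofReal δ := by
    -- For `δ ≥ 1` there is nothing to prove. For `δ < 1` the existence of an agent gives `δ ≤ 2 *
    -- n`, so the logarithm in `estError` is nonnegative.
    rcases le_or_gt 1 δ with h1 | h1
    · exact prob_le_one.trans (by simpa using ENNReal.ofReal_le_ofReal h1)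
    let B : ∀ i : Fin n, Set (Fin N → Others n m i) := fun i =>
      {s | ∃ M t r, empGain u i s M t r + estError n N δ (d i) < expGain u ν i M t r}
    have hB : ∀ i, P {ω | S i ω ∈ B i} ≤ ENNReal.ofReal (δ / (2 * n)) := fun i => by
      have hn : (1 : ℝ) ≤ n := by exact_mod_cast i.pos
      exact ((hS i).measure_setOf_mem_le (B i)).trans
        (measure_exists_expGain_gt_le hu (hmeas i) ν (hd i).le hN (hdN i) hδ (by linarith))
    -- The union bound needs no independence between the samples of different agents, and the total
    -- is at most `δ / 2`.
    calc _ ≤ P (⋃ i, {ω | S i ω ∈ B i}) := by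
          refine measure_mono fun ω hω => ?_
          by_contra hnot
          refine hω fun L w k G hL hG hD M i t r => ?_
          have hi : S i ω ∉ B i := fun h => hnot (Set.mem_iUnion.2 ⟨i, h⟩)
          have hle : expGain u ν i M t r ≤ empGain u i (S i ω) M t r + estError n N δ (d i) :=
            not_lt.1 fun h => hi ⟨M, t, r, h⟩
          have := empGain_le_of_dispersionHolds hu hN (hL i) hD (hG i) M t r
          linarith
      _ ≤ ∑ i, P {ω | S i ω ∈ B i} := measure_iUnion_fintype_le _ _
      _ ≤ ∑ _i : Fin n, ENNReal.ofReal (δ / (2 * n)) := Finset.sum_le_sum fun i _ => hB i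
      _ ≤ ENNReal.ofReal δ := by
          rw [← ENNReal.ofReal_sum_of_nonneg fun _ _ => by positivity]
          refine ENNReal.ofReal_le_ofReal ?_
          rw [Finset.sum_const, Finset.card_univ, Fintype.card_fin, nsmul_eq_mul]
          rcases Nat.eq_zero_or_pos n with h0 | h0
          · simp [h0, hδ.le]
          · have : (0 : ℝ) < n := by exact_mod_cast h0
            have e : n * (δ / (2 * n)) = δ / 2 := by field_simp
            rw [e]
            linarith
  refine ⟨fun L w k G hL hG hD => ?_, hpart2⟩
  rw [two_mul, ENNReal.ofReal_add hδ.le hδ.le]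
  refine le_trans (measure_mono fun ω hω => ?_)
    ((measure_union_le _ _).trans (add_le_add hD hpart2))
  -- If the gap bound fails, then either dispersion fails or the sample lies in the exceptional
  -- event of `hpart2`; each has probability at most `δ`.
  by_cases h : DispersionHolds u L w k fun i => S i ω
  · exact Or.inr fun hall => hω (hall L w k G hL hG h)
  · exact Or.inl h
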